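/- Let $A\in\mathbb R^{n\times n}$ be a symmetric positive-semidefinite matrix, $b\in\mathbb R^n$, $\alpha\in\mathbb R$, let $f(x)=\frac12\langle Ax,x\rangle+\langle b,x\rangle+\alpha$, and let $g:\mathbb R^n\to(-\infty,\infty]$ be proper, lower semicontinuous and convex. Let $\gamma>0$ be such that $B:=I-\gamma A$ is positive-definite, let $$\varphi_\gamma(x):=\inf_{y\in\mathbb R^n}\Big\{f(x)+\langle\nabla f(x),y-x\rangle+g(y)+\frac1{2\gamma}\|y-x\|^2\Big\}$$ be the forward-backward envelope of $\varphi=f+g$, and let $\mathrm{Prox}_{\gamma g}(u):=\operatorname{argmin}_{y\in\mathbb R^n}\{g(y)+\frac1{2\gamma}\|y-u\|^2\}$. Notation: for $\Omega\subset\mathbb R^s$ and $\bar\zeta\in\Omega$, $\widehat N_\Omega(\bar\zeta)$ is the set of $v$ with $\limsup_{\zeta\to\bar\zeta,\ \zeta\in\Omega\setminus\{\bar\zeta\}}\langle v,\zeta-\bar\zeta\rangle/\|\zeta-\bar\zeta\|\le0$ (all of $\mathbb R^s$ if $\bar\zeta$ is isolated in $\Omega$), and $N_\Omega(\bar\zeta)$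 is the set of limits of sequences $v_k\in\widehat N_\Omega(\zeta_k)$ with $\zeta_k\in\Omega$, $\zeta_k\to\bar\zeta$; both are empty if $\bar\zeta\notin\Omega$. For $\psi:\mathbb R^n\to[-\infty,\infty]$ and $\psi(x)$ finite, $\partial\psi(x):=\{v\mid(v,-1)\in N_{\mathrm{epi}\,\psi}(x,\psi(x))\}$ (and $\partial\psi(x):=\emptyset$ otherwise), and the generalized Hessian is $\partial^2\psi(x,v)(w):=\{z\mid(z,-w)\in N_{\mathrm{gph}\,\partial\psi}(x,v)\}$; if $\partial\psi(x)=\{v\}$ is a singleton, one writes $\partial^2\psi(x)(w)$ for $\partial^2\psi(x,v)(w)$. Let $\bar x\in\mathbb R^n$ and $\bar u:=\bar x-\gamma(A\bar x+b)$. Then $\mathrm{Prox}_{\gamma g}(\bar u)$ and $\partial\varphi_\gamma(\bar x)$ are singletons, and for all $w,\bar z\in\mathbb R^n$ $$\bar z\in\partial^2\varphi_\gamma(\bar x)(w)\iff B^{-1}\bar z-Aw\in\partial^2g\Big(\mathrm{Prox}_{\gamma g}(\bar u),\tfrac1\gamma\big(\bar u-\mathrm{Prox}_{\gamma g}(\bar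 u)\big)\Big)\big(w-\gamma B^{-1}\bar z\big).$$ -/

import Mathlib

open Filter Topology

namespace VarAnalysis

noncomputable section

/-- The (Fréchet) regular normal cone to `Ω` at `z`; empty if `z ∉ Ω`. The upper limit is taken in
the extended reals over `z' → z` with `z' ∈ Ω`, `z' ≠ z`, so it is `-∞` at an isolated point,
where every vector is a regular normal. -/
def regularNormalCone {H : Type*} [NormedAddCommGroup H] [InnerProductSpace ℝ H]
    (Ω : Set H) (z : H) : Set H :=
  {v | z ∈ Ω ∧
    limsup (fun z' : H => ((inner ℝ v (z' - z) / ‖z' - z‖ : ℝ) : EReal)) (𝓝[Ω \ {z}] z) ≤ 0}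

/-- The (Mordukhovich) limiting normal cone to `Ω` at `z`; empty if `z ∉ Ω`. -/
def limitingNormalCone {H : Type*} [NormedAddCommGroup H] [InnerProductSpace ℝ H]
    (Ω : Set H) (z : H) : Set H :=
  {v | z ∈ Ω ∧ ∃ (zs vs : ℕ → H), (∀ k, zs k ∈ Ω) ∧ Tendsto zs atTop (𝓝 z) ∧
    Tendsto vs atTop (𝓝 v) ∧ ∀ k, vs k ∈ regularNormalCone Ω (zs k)}

/-- The graph of a set-valued mapping, in the product with its Euclidean (Hilbert) norm. -/
def gph {X Y : Type*} (F : X → Set Y) : Set (WithLp 2 (X × Y)) :=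
  {p | p.snd ∈ F p.fst}

/-- The limiting coderivative `D*F(x, y)(v)`. -/
def coderivative {X Y : Type*} [NormedAddCommGroup X] [InnerProductSpace ℝ X]
    [NormedAddCommGroup Y] [InnerProductSpace ℝ Y]
    (F : X → Set Y) (x : X) (y : Y) (v : Y) : Set X :=
  {u | WithLp.toLp 2 (u, -v) ∈ limitingNormalCone (gph F) (WithLp.toLp 2 (x, y))}

/-- The epigraph of an extended-real-valued function. -/
def epigraph {X : Type*} (φ : X → EReal) : Set (WithLp 2 (X × ℝ)) :=
  {p | φ p.fst ≤ (p.snd : EReal)}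

/-- The limiting subdifferential `∂φ(x)`; empty if `φ x` is not finite. -/
def subdifferential {X : Type*} [NormedAddCommGroup X] [InnerProductSpace ℝ X]
    (φ : X → EReal) (x : X) : Set X :=
  {v | φ x ≠ ⊥ ∧ φ x ≠ ⊤ ∧ WithLp.toLp 2 (v, (-1 : ℝ)) ∈
    limitingNormalCone (epigraph φ) (WithLp.toLp 2 (x, (φ x).toReal))}

/-- The generalized Hessian (second-order subdifferential) `∂²φ(x, v)(w)`. -/
def generalizedHessian {X : Type*} [NormedAddCommGroup X] [InnerProductSpace ℝ X]
    (φ : X → EReal) (x v w : X) : Set X :=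
  coderivative (subdifferential φ) x v w

/-- A proper function with values in `(-∞, ∞]`. -/
def IsProper {X : Type*} (g : X → EReal) : Prop :=
  (∀ x, g x ≠ ⊥) ∧ ∃ x, g x ≠ ⊤

/-- The set of minimizers of `y ↦ g y + ‖y - u‖² / (2γ)`, that is, `Prox_{γ g}(u)` as a set. -/
def prox {X : Type*} [NormedAddCommGroup X] (γ : ℝ) (g : X → EReal) (u : X) : Set X :=
  {p | ∀ y, g p + ((1 / (2 * γ) * ‖p - u‖ ^ 2 : ℝ) : EReal) ≤
    g y + ((1 / (2 * γ) * ‖y - u‖ ^ 2 : ℝ) : EReal)}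

/-- The forward-backward envelope of `f + g` with parameter `γ`. -/
def forwardBackwardEnvelope {X : Type*} [NormedAddCommGroup X] [InnerProductSpace ℝ X]
    [CompleteSpace X] (γ : ℝ) (f : X → ℝ) (g : X → EReal) (x : X) : EReal :=
  ⨅ y : X, ((f x + inner ℝ (gradient f x) (y - x) : ℝ) : EReal) + g y +
    ((1 / (2 * γ) * ‖y - x‖ ^ 2 : ℝ) : EReal)

/-- The quadratic function `x ↦ ½⟨Ax, x⟩ + ⟨b, x⟩ + α`. -/
def quadratic {n : ℕ} (A : Matrix (Fin n) (Fin n) ℝ) (b : EuclideanSpace ℝ (Fin n)) (α : ℝ)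
    (x : EuclideanSpace ℝ (Fin n)) : ℝ :=
  1 / 2 * inner ℝ (Matrix.toEuclideanLin A x) x + inner ℝ b x + α

end

end VarAnalysis

/-! Write P for the proximal map and D for the inverse of B. Completing the square shows that the
infimum defining the envelope is attained exactly at p = P(x - γ(Ax + b)), and the envelope has
gradient field G(x) = γ⁻¹B(x - p) (`subdifferential_forwardBackwardEnvelope`). Put u = x - γ(Ax +
b). The equation y = G(x) says p = x - γDy, and then γ⁻¹(u - p) = Dy - Ax - b. Since p = P(u) is
equivalent to γ⁻¹(u - p) ∈ ∂g(p), the graph of the envelope's subdifferential is the preimage of gph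
∂g under the invertible affine map (x, y) ↦ (x - γDy, Dy - Ax - b). Limiting normals pull back along
such a map by the adjoint of its linear part (`adjoint_mem_limitingNormalCone_preimage_iff`). This
adjoint sends (Dz - Aw, -(w - γDz)) to (z, -w) (`adjoint_envelopeGraphEquiv`), which is the claimed
equivalence. -/

namespace VarAnalysis

/-! ### Normal cones: arcs, convex sets, affine changes of variables. -/

section NormalCones

variable {H K : Type*} [NormedAddCommGroup H] [InnerProductSpace ℝ H]
  [NormedAddCommGroup K] [InnerProductSpace ℝ K]

/-- With the denominator cleared, z' = z is harmless and isolated points need no separate case. -/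
theorem mem_regularNormalCone_iff {Ω : Set H} {z v : H} :
    v ∈ regularNormalCone Ω z ↔
      z ∈ Ω ∧ ∀ ε > 0, ∀ᶠ z' in 𝓝[Ω] z, inner ℝ v (z' - z) ≤ ε * ‖z' - z‖ := by
  refine and_congr_right fun _ => ?_
  rw [limsup_le_iff]
  constructor
  · intro h ε hε
    have h1 := h (ε : EReal) (by exact_mod_cast hε)
    rw [eventually_nhdsWithin_iff] at h1 ⊢
    filter_upwards [h1] with z' hz' hmem
    by_cases hzz : z' = z
    · simp [hzz]
    · have h2 := hz' ⟨hmem, hzz⟩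
      have h3 : inner ℝ v (z' - z) / ‖z' - z‖ < ε := by exact_mod_cast h2
      have h4 : 0 < ‖z' - z‖ := norm_pos_iff.2 (sub_ne_zero.2 hzz)
      rw [div_lt_iff₀ h4] at h3
      exact h3.le
  · intro h y hy
    obtain ⟨ε, hε, hεy⟩ := EReal.lt_iff_exists_real_btwn.1 hy
    have h1 := h ε (by exact_mod_cast hε)
    rw [eventually_nhdsWithin_iff] at h1 ⊢
    filter_upwards [h1] with z' hz' hmem
    refine lt_of_le_of_lt ?_ hεy
    have h4 : 0 < ‖z' - z‖ := norm_pos_iff.2 (sub_ne_zero.2 hmem.2)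
    exact_mod_cast (div_le_iff₀ h4).2 (hz' hmem.1)

theorem regularNormalCone_subset_limitingNormalCone (Ω : Set H) (z : H) :
    regularNormalCone Ω z ⊆ limitingNormalCone Ω z := fun v hv =>
  ⟨hv.1, fun _ => z, fun _ => v, fun _ => hv.1, tendsto_const_nhds, tendsto_const_nhds,
    fun _ => hv⟩

/-- A regular normal makes a nonpositive inner product with the initial velocity of a quadratic
arc which stays in the set. -/
theorem inner_nonpos_of_mem_regularNormalCone {Ω : Set H} {z v d e : H}
    (hv : v ∈ regularNormalCone Ω z)
    (harc : ∀ᶠ s : ℝ in 𝓝[>] 0, z + (s • d + s ^ 2 • e) ∈ Ω) : inner ℝ v d ≤ 0 := by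
  have key : ∀ ε > 0, inner ℝ v d ≤ ε * ‖d‖ := by
    intro ε hε
    have hcont : Tendsto (fun s : ℝ => z + (s • d + s ^ 2 • e)) (𝓝[>] 0) (𝓝 z) := by
      have : Continuous (fun s : ℝ => z + (s • d + s ^ 2 • e)) := by fun_prop
      simpa using (this.tendsto 0).mono_left nhdsWithin_le_nhds
    have hev := (tendsto_nhdsWithin_iff.2 ⟨hcont, harc⟩).eventually
      ((mem_regularNormalCone_iff.1 hv).2 ε hε)
    have hle : ∀ᶠ s : ℝ in 𝓝[>] 0, inner ℝ v (d + s • e) ≤ ε * ‖d + s • e‖ := by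
      filter_upwards [hev, self_mem_nhdsWithin] with s hs hpos
      have hpos' : 0 < s := hpos
      have h1 : z + (s • d + s ^ 2 • e) - z = s • (d + s • e) := by
        rw [add_sub_cancel_left, smul_add, smul_smul, sq]
      rw [h1, inner_smul_right, norm_smul, Real.norm_of_nonneg hpos'.le] at hs
      exact le_of_mul_le_mul_left (by linarith) hpos'
    have hl : Tendsto (fun s : ℝ => inner ℝ v (d + s • e)) (𝓝[>] 0) (𝓝 (inner ℝ v d)) := by
      have : Continuous (fun s : ℝ => inner ℝ v (d + s • e)) := by fun_prop
      simpa using (this.tendsto 0).mono_left nhdsWithin_le_nhds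
    have hr : Tendsto (fun s : ℝ => ε * ‖d + s • e‖) (𝓝[>] 0) (𝓝 (ε * ‖d‖)) := by
      have : Continuous (fun s : ℝ => ε * ‖d + s • e‖) := by fun_prop
      simpa using (this.tendsto 0).mono_left nhdsWithin_le_nhds
    exact le_of_tendsto_of_tendsto hl hr hle
  have hlim : Tendsto (fun ε : ℝ => ε * ‖d‖) (𝓝[>] 0) (𝓝 0) := by
    have : Continuous (fun ε : ℝ => ε * ‖d‖) := by fun_prop
    simpa using (this.tendsto 0).mono_left nhdsWithin_le_nhds
  exact ge_of_tendsto hlim (by filter_upwards [self_mem_nhdsWithin] with ε hε using key ε hε)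

/-- Segments to points of Ω are admissible arcs, so regular normals satisfy the global inequality,
and that inequality survives limits. -/
theorem mem_limitingNormalCone_iff_of_convex {Ω : Set H} (hΩ : Convex ℝ Ω) {z v : H} :
    v ∈ limitingNormalCone Ω z ↔ z ∈ Ω ∧ ∀ z' ∈ Ω, inner ℝ v (z' - z) ≤ 0 := by
  constructor
  · rintro ⟨hz, zs, vs, hzs, hlz, hlv, hvs⟩
    refine ⟨hz, fun z' hz' => ?_⟩
    have hle : ∀ k, inner ℝ (vs k) (z' - zs k) ≤ 0 := fun k => by
      refine inner_nonpos_of_mem_regularNormalCone (e := 0) (hvs k) ?_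
      filter_upwards [Ioo_mem_nhdsGT (zero_lt_one' ℝ)] with s hs
      rw [smul_zero, add_zero]
      exact hΩ.add_smul_sub_mem (hzs k) hz' ⟨hs.1.le, hs.2.le⟩
    exact le_of_tendsto' (hlv.inner (tendsto_const_nhds.sub hlz)) hle
  · rintro ⟨hz, h⟩
    refine regularNormalCone_subset_limitingNormalCone _ _
      (mem_regularNormalCone_iff.2 ⟨hz, fun ε hε => ?_⟩)
    filter_upwards [self_mem_nhdsWithin] with z' hz'
    exact (h z' hz').trans (by positivity)

theorem adjoint_mem_regularNormalCone_preimage [CompleteSpace H] [CompleteSpace K]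
    (L : H →L[ℝ] K) (c : K) {Ω : Set K} {z : H} {v : K}
    (hv : v ∈ regularNormalCone Ω (L z + c)) :
    ContinuousLinearMap.adjoint L v ∈ regularNormalCone ((fun x => L x + c) ⁻¹' Ω) z := by
  rw [mem_regularNormalCone_iff] at hv ⊢
  refine ⟨hv.1, fun ε hε => ?_⟩
  have hpos : 0 < ‖L‖ + 1 := by positivity
  have hev := hv.2 (ε / (‖L‖ + 1)) (by positivity)
  have hcont : Tendsto (fun x => L x + c) (𝓝[(fun x => L x + c) ⁻¹' Ω] z) (𝓝[Ω] (L z + c)) := by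
    have : Continuous (fun x => L x + c) := by fun_prop
    exact tendsto_nhdsWithin_iff.2 ⟨(this.tendsto z).mono_left nhdsWithin_le_nhds,
      self_mem_nhdsWithin⟩
  filter_upwards [hcont.eventually hev] with z' hz'
  rw [add_sub_add_right_eq_sub, ← map_sub] at hz'
  rw [ContinuousLinearMap.adjoint_inner_left]
  refine hz'.trans ?_
  calc ε / (‖L‖ + 1) * ‖L (z' - z)‖ ≤ ε / (‖L‖ + 1) * ((‖L‖ + 1) * ‖z' - z‖) := by
        gcongr
        exact (L.le_opNorm _).trans (by gcongr; linarith)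
    _ = ε * ‖z' - z‖ := by field_simp

/-- Invertibility is what allows the approximating base points in Ω to be pulled back. -/
theorem adjoint_mem_limitingNormalCone_preimage [CompleteSpace H] [CompleteSpace K]
    (L : H ≃L[ℝ] K) (c : K) {Ω : Set K} {z : H} {v : K}
    (hv : v ∈ limitingNormalCone Ω (L z + c)) :
    ContinuousLinearMap.adjoint (L : H →L[ℝ] K) v ∈
      limitingNormalCone ((fun x => L x + c) ⁻¹' Ω) z := by
  obtain ⟨hz, zs, vs, hzs, hlz, hlv, hvs⟩ := hv
  refine ⟨hz, fun k => L.symm (zs k - c), fun k => ContinuousLinearMap.adjoint (L : H →L[ℝ] K)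
    (vs k), fun k => by simpa using hzs k, ?_, ?_, fun k => ?_⟩
  · have : Continuous (fun y => L.symm (y - c)) := by fun_prop
    have h := (this.tendsto _).comp hlz
    rwa [add_sub_cancel_right, L.symm_apply_apply] at h
  · exact ((ContinuousLinearMap.continuous _).tendsto _).comp hlv
  · refine adjoint_mem_regularNormalCone_preimage (L : H →L[ℝ] K) c ?_
    simpa using hvs k

/-- Limiting normal cones under an invertible affine change of variables. -/
theorem adjoint_mem_limitingNormalCone_preimage_iff [CompleteSpace H] [CompleteSpace K]
    (L : H ≃L[ℝ] K) (c : K) {Ω : Set K} {z : H} {v : K} :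
    ContinuousLinearMap.adjoint (L : H →L[ℝ] K) v ∈
      limitingNormalCone ((fun x => L x + c) ⁻¹' Ω) z ↔
      v ∈ limitingNormalCone Ω (L z + c) := by
  refine ⟨fun h => ?_, adjoint_mem_limitingNormalCone_preimage L c⟩
  have hz : L.symm (L z + c) + -(L.symm c) = z := by simp
  rw [← hz] at h
  have h1 := adjoint_mem_limitingNormalCone_preimage L.symm (-(L.symm c)) h
  have h2 : ContinuousLinearMap.adjoint (L.symm : K →L[ℝ] H)
      (ContinuousLinearMap.adjoint (L : H →L[ℝ] K) v) = v := by
    refine ext_inner_right ℝ fun y => ?_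
    simp [ContinuousLinearMap.adjoint_inner_left]
  rw [h2, ← Set.preimage_comp] at h1
  convert h1 using 2
  ext y
  simp

end NormalCones

/-! ### Limiting subdifferentials of smooth and of convex functions. -/

section Subdifferential

variable {X : Type*} [NormedAddCommGroup X] [InnerProductSpace ℝ X]

/-- The limiting subdifferential of a function with a quadratic upper estimate along a Lipschitz
field is the value of that field. -/
theorem subdifferential_coe_eq_singleton {ψ : X → ℝ} {G : X → X} {C M : ℝ}
    (hψ : ∀ x y, ψ y ≤ ψ x + inner ℝ (G x) (y - x) + C * ‖y - x‖ ^ 2)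
    (hG : ∀ x y, ‖G y - G x‖ ≤ M * ‖y - x‖) (x : X) :
    subdifferential (fun y => (ψ y : EReal)) x = {G x} := by
  have hGc : Continuous G := by
    refine (LipschitzWith.of_dist_le_mul (K := M.toNNReal) fun a b => ?_).continuous
    rw [dist_eq_norm, dist_eq_norm]
    exact (hG b a).trans (by gcongr; exact Real.le_coe_toNNReal M)
  ext v
  rw [Set.mem_singleton_iff]
  constructor
  · rintro ⟨-, -, -, zs, vs, hzs, hlz, hlv, hvs⟩
    -- By the upper estimate, from any point of the epigraph the arc with velocity (d, ⟨G, d⟩) and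
    -- second-order term C‖d‖² stays in the epigraph. As d is arbitrary, every regular normal is a
    -- multiple of (G, -1).
    have hfst : ∀ k, (vs k).fst = -((vs k).snd • G (zs k).fst) := by
      intro k
      have hle : ∀ d : X, inner ℝ ((vs k).fst + (vs k).snd • G (zs k).fst) d ≤ 0 := by
        intro d
        have h := inner_nonpos_of_mem_regularNormalCone
          (d := WithLp.toLp 2 (d, inner ℝ (G (zs k).fst) d))
          (e := WithLp.toLp 2 ((0 : X), C * ‖d‖ ^ 2)) (hvs k) ?_
        · rw [WithLp.prod_inner_apply] at h
          simp only [RCLike.inner_apply, conj_trivial] at h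
          rw [inner_add_left, inner_smul_left]
          simp only [conj_trivial]
          have h' : inner ℝ (vs k).fst d + inner ℝ (G (zs k).fst) d * (vs k).snd ≤ 0 := h
          linarith
        · refine Eventually.of_forall fun s => ?_
          have h1 : ψ (zs k).fst ≤ (zs k).snd := by
            have := hzs k
            simpa [epigraph] using this
          have h2 := hψ (zs k).fst ((zs k).fst + s • d)
          rw [add_sub_cancel_left, inner_smul_right, norm_smul, mul_pow, Real.norm_eq_abs,
            sq_abs] at h2
          change ((ψ ((zs k).fst + (s • d + s ^ 2 • (0 : X))) : ℝ) : EReal) ≤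
            (((zs k).snd + (s * inner ℝ (G (zs k).fst) d + s ^ 2 * (C * ‖d‖ ^ 2)) : ℝ) : EReal)
          rw [smul_zero, add_zero, EReal.coe_le_coe_iff]
          linarith
      have h0 := hle ((vs k).fst + (vs k).snd • G (zs k).fst)
      exact eq_neg_of_add_eq_zero_left ((real_inner_self_nonpos).1 h0)
    have hc1 : Continuous fun q : WithLp 2 (X × ℝ) => q.fst := by fun_prop
    have hc2 : Continuous fun q : WithLp 2 (X × ℝ) => q.snd := by fun_prop
    have t1 : Tendsto (fun k => (vs k).fst) atTop (𝓝 v) := (hc1.tendsto _).comp hlv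
    have t2 : Tendsto (fun k => (vs k).snd) atTop (𝓝 (-1)) := (hc2.tendsto _).comp hlv
    have t3 : Tendsto (fun k => (zs k).fst) atTop (𝓝 x) := (hc1.tendsto _).comp hlz
    have t4 := (t2.smul ((hGc.tendsto x).comp t3)).neg
    have t5 : Tendsto (fun k => (vs k).fst) atTop (𝓝 (-((-1 : ℝ) • G x))) :=
      t4.congr fun k => (hfst k).symm
    simpa using tendsto_nhds_unique t1 t5
  · rintro rfl
    refine ⟨EReal.coe_ne_bot _, EReal.coe_ne_top _, regularNormalCone_subset_limitingNormalCone _ _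
      (mem_regularNormalCone_iff.2 ⟨by simp [epigraph], fun ε hε => ?_⟩)⟩
    rw [EReal.toReal_coe]
    set D : ℝ := |M + C|
    have hsmall : ∀ᶠ q in 𝓝[epigraph fun y => (ψ y : EReal)] (WithLp.toLp 2 (x, ψ x)),
        D * ‖q - WithLp.toLp 2 (x, ψ x)‖ < ε := by
      have : Continuous fun q : WithLp 2 (X × ℝ) => D * ‖q - WithLp.toLp 2 (x, ψ x)‖ := by
        fun_prop
      have ht := (this.tendsto (WithLp.toLp 2 (x, ψ x))).mono_left
        (nhdsWithin_le_nhds (s := epigraph fun y => (ψ y : EReal)))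
      simp only [sub_self, norm_zero, mul_zero] at ht
      exact ht.eventually (gt_mem_nhds hε)
    filter_upwards [hsmall, self_mem_nhdsWithin] with q hq hmem
    have hq1 : ψ q.fst ≤ q.snd := by simpa [epigraph] using hmem
    have hin : inner ℝ (WithLp.toLp 2 (G x, (-1 : ℝ))) (q - WithLp.toLp 2 (x, ψ x)) =
        inner ℝ (G x) (q.fst - x) - (q.snd - ψ x) := by
      rw [WithLp.prod_inner_apply]
      simp
      ring
    rw [hin]
    -- Exchanging the two points turns the upper estimate into a lower one; the Lipschitz bound then
    -- replaces G at the moving point by G at x, at quadratic cost.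
    have h1 := hψ q.fst x
    have h2 : inner ℝ (G x - G q.fst) (q.fst - x) ≤ M * ‖q.fst - x‖ ^ 2 := by
      refine (real_inner_le_norm _ _).trans ?_
      have := mul_le_mul_of_nonneg_right (hG q.fst x) (norm_nonneg (q.fst - x))
      rw [norm_sub_rev x] at this
      linarith
    have h3 : inner ℝ (G q.fst) (x - q.fst) = - inner ℝ (G q.fst) (q.fst - x) := by
      rw [← inner_neg_right, neg_sub]
    rw [inner_sub_left] at h2
    rw [h3, norm_sub_rev x] at h1
    have h4 : ‖q.fst - x‖ ^ 2 ≤ ‖q - WithLp.toLp 2 (x, ψ x)‖ ^ 2 := by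
      rw [WithLp.prod_norm_sq_eq_of_L2]
      exact le_add_of_nonneg_right (sq_nonneg _)
    have h5 : (M + C) * ‖q.fst - x‖ ^ 2 ≤ D * ‖q - WithLp.toLp 2 (x, ψ x)‖ ^ 2 :=
      mul_le_mul (le_abs_self _) h4 (by positivity) (abs_nonneg _)
    have h6 : D * ‖q - WithLp.toLp 2 (x, ψ x)‖ ^ 2 ≤ ε * ‖q - WithLp.toLp 2 (x, ψ x)‖ := by
      rw [sq, ← mul_assoc]
      gcongr
    linarith

/-- For a convex function the limiting subdifferential is the one of convex analysis. -/
theorem mem_subdifferential_iff_of_convex {g : X → EReal} (hbot : ∀ x, g x ≠ ⊥)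
    (hg : Convex ℝ (epigraph g)) {x v : X} :
    v ∈ subdifferential g x ↔ g x ≠ ⊤ ∧
      ∀ y, g y ≠ ⊤ → (g x).toReal + inner ℝ v (y - x) ≤ (g y).toReal := by
  have hinner : ∀ q : WithLp 2 (X × ℝ),
      inner ℝ (WithLp.toLp 2 (v, (-1 : ℝ))) (q - WithLp.toLp 2 (x, (g x).toReal)) =
        inner ℝ v (q.fst - x) - (q.snd - (g x).toReal) := by
    intro q
    rw [WithLp.prod_inner_apply]
    simp
    ring
  constructor
  · rintro ⟨-, htop, h⟩
    refine ⟨htop, fun y hy => ?_⟩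
    have h1 := ((mem_limitingNormalCone_iff_of_convex hg).1 h).2 (WithLp.toLp 2 (y, (g y).toReal))
      (by simp [epigraph, EReal.coe_toReal hy (hbot y)])
    rw [hinner] at h1
    change inner ℝ v (y - x) - ((g y).toReal - (g x).toReal) ≤ 0 at h1
    linarith
  · rintro ⟨htop, h⟩
    refine ⟨hbot x, htop, (mem_limitingNormalCone_iff_of_convex hg).2
      ⟨by simp [epigraph, EReal.coe_toReal htop (hbot x)], fun q hq => ?_⟩⟩
    have hq' : g q.fst ≤ (q.snd : EReal) := hq
    have hy : g q.fst ≠ ⊤ := fun h0 => by simp [h0] at hq'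
    have h1 := h q.fst hy
    have h2 : (g q.fst).toReal ≤ q.snd := by
      rw [← EReal.coe_toReal hy (hbot _)] at hq'
      exact_mod_cast hq'
    rw [hinner]
    linarith

end Subdifferential

end VarAnalysis

namespace VarAnalysis

/-! ### The proximal map: optimality condition, nonexpansiveness, existence. -/

section Prox

variable {X : Type*} [NormedAddCommGroup X]

theorem toReal_le_of_convex_epigraph [InnerProductSpace ℝ X] {g : X → EReal}
    (hbot : ∀ x, g x ≠ ⊥) (hg : Convex ℝ (epigraph g)) {x y : X} (hx : g x ≠ ⊤) (hy : g y ≠ ⊤)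
    {s : ℝ} (hs0 : 0 ≤ s) (hs1 : s ≤ 1) :
    g (x + s • (y - x)) ≠ ⊤ ∧
      (g (x + s • (y - x))).toReal ≤ (g x).toReal + s * ((g y).toReal - (g x).toReal) := by
  have hmem : ∀ z, g z ≠ ⊤ → WithLp.toLp 2 (z, (g z).toReal) ∈ epigraph g := fun z hz => by
    simp [epigraph, EReal.coe_toReal hz (hbot z)]
  have h : g (x + s • (y - x)) ≤
      (((g x).toReal + s * ((g y).toReal - (g x).toReal) : ℝ) : EReal) :=
    hg.add_smul_sub_mem (hmem x hx) (hmem y hy) ⟨hs0, hs1⟩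
  have htop : g (x + s • (y - x)) ≠ ⊤ := fun h0 => by
    rw [h0, top_le_iff] at h
    exact EReal.coe_ne_top _ h
  refine ⟨htop, ?_⟩
  rw [← EReal.coe_toReal htop (hbot _)] at h
  exact_mod_cast h

theorem mem_prox_iff {g : X → EReal} (hg : IsProper g) {γ : ℝ} {u p : X} :
    p ∈ prox γ g u ↔ g p ≠ ⊤ ∧ ∀ y, g y ≠ ⊤ →
      (g p).toReal + 1 / (2 * γ) * ‖p - u‖ ^ 2 ≤ (g y).toReal + 1 / (2 * γ) * ‖y - u‖ ^ 2 := by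
  obtain ⟨hbot, x₀, hx₀⟩ := hg
  constructor
  · intro h
    have hp : g p ≠ ⊤ := fun h0 => by
      have h1 := h x₀
      rw [h0, EReal.top_add_coe, top_le_iff, ← EReal.coe_toReal hx₀ (hbot x₀),
        ← EReal.coe_add] at h1
      exact EReal.coe_ne_top _ h1
    refine ⟨hp, fun y hy => ?_⟩
    have h1 := h y
    rw [← EReal.coe_toReal hy (hbot y), ← EReal.coe_toReal hp (hbot p)] at h1
    exact_mod_cast h1
  · rintro ⟨hp, h⟩ y
    by_cases hy : g y = ⊤
    · rw [hy, EReal.top_add_coe]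
      exact le_top
    · rw [← EReal.coe_toReal hy (hbot y), ← EReal.coe_toReal hp (hbot p)]
      exact_mod_cast h y hy

variable [InnerProductSpace ℝ X]

theorem norm_sub_sq_expand (p u d : X) :
    ‖p + d - u‖ ^ 2 = ‖p - u‖ ^ 2 - 2 * inner ℝ (u - p) d + ‖d‖ ^ 2 := by
  have h : p + d - u = (p - u) + d := by abel
  rw [h, norm_add_sq_real, ← neg_sub u p, inner_neg_left, norm_neg]
  ring

/-- Fermat's rule: compare p with p + s(y - p), divide by s and let s → 0. Conversely, the
subgradient inequality leaves a spare nonnegative square. -/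
theorem mem_prox_iff_mem_subdifferential {g : X → EReal} (hg : IsProper g)
    (hconv : Convex ℝ (epigraph g)) {γ : ℝ} (hγ : 0 < γ) {u p : X} :
    p ∈ prox γ g u ↔ (1 / γ) • (u - p) ∈ subdifferential g p := by
  rw [mem_prox_iff hg, mem_subdifferential_iff_of_convex hg.1 hconv]
  refine and_congr_right fun hp => ⟨fun h y hy => ?_, fun h y hy => ?_⟩
  · rw [inner_smul_left, conj_trivial]
    have hev : ∀ᶠ s : ℝ in 𝓝[>] 0, (g p).toReal + 1 / γ * inner ℝ (u - p) (y - p) ≤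
        (g y).toReal + s * (1 / (2 * γ) * ‖y - p‖ ^ 2) := by
      filter_upwards [Ioo_mem_nhdsGT (zero_lt_one' ℝ)] with s hs
      obtain ⟨h1, h2⟩ := toReal_le_of_convex_epigraph hg.1 hconv hp hy hs.1.le hs.2.le
      have h3 := h _ h1
      rw [norm_sub_sq_expand, inner_smul_right, norm_smul, mul_pow, Real.norm_eq_abs,
        sq_abs] at h3
      have h4 : 1 / γ = 2 * (1 / (2 * γ)) := by field_simp
      rw [h4]
      refine le_of_mul_le_mul_left ?_ hs.1
      linarith
    have hlim : Tendsto (fun s : ℝ => (g y).toReal + s * (1 / (2 * γ) * ‖y - p‖ ^ 2)) (𝓝[>] 0)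
        (𝓝 (g y).toReal) := by
      have : Continuous fun s : ℝ => (g y).toReal + s * (1 / (2 * γ) * ‖y - p‖ ^ 2) := by
        fun_prop
      simpa using (this.tendsto 0).mono_left nhdsWithin_le_nhds
    exact ge_of_tendsto hlim hev
  · have h1 := h y hy
    rw [inner_smul_left, conj_trivial] at h1
    have h2 := norm_sub_sq_expand p u (y - p)
    rw [add_sub_cancel] at h2
    have h4 : 1 / γ = 2 * (1 / (2 * γ)) := by field_simp
    rw [h4] at h1
    rw [h2]
    have h5 : 0 ≤ 1 / (2 * γ) * ‖y - p‖ ^ 2 := by positivity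
    linarith

/-- Monotonicity of ∂g gives ‖p' - p‖² ≤ ⟨u' - u, p' - p⟩; Cauchy–Schwarz finishes. -/
theorem norm_sub_le_of_mem_prox {g : X → EReal} (hg : IsProper g)
    (hconv : Convex ℝ (epigraph g)) {γ : ℝ} (hγ : 0 < γ) {u u' p p' : X}
    (hp : p ∈ prox γ g u) (hp' : p' ∈ prox γ g u') : ‖p' - p‖ ≤ ‖u' - u‖ := by
  rw [mem_prox_iff_mem_subdifferential hg hconv hγ,
    mem_subdifferential_iff_of_convex hg.1 hconv] at hp hp'
  have h1 := hp.2 p' hp'.1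
  have h2 := hp'.2 p hp.1
  rw [inner_smul_left, conj_trivial] at h1 h2
  have h3 : 1 / γ * (inner ℝ (u - p) (p' - p) + inner ℝ (u' - p') (p - p')) ≤ 0 := by linarith
  have h4 : inner ℝ (u - p) (p' - p) + inner ℝ (u' - p') (p - p') ≤ 0 := by
    by_contra! h
    exact absurd h3 (not_le.2 (by positivity))
  have h5 : inner ℝ (u - p) (p' - p) + inner ℝ (u' - p') (p - p') =
      ‖p' - p‖ ^ 2 - inner ℝ (u' - u) (p' - p) := by
    rw [← neg_sub p' p, inner_neg_right, ← sub_eq_add_neg, ← inner_sub_left,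
      ← real_inner_self_eq_norm_sq, ← inner_sub_left]
    congr 1
    abel
  have h6 := real_inner_le_norm (u' - u) (p' - p)
  rcases (norm_nonneg (p' - p)).eq_or_lt with h0 | h0
  · rw [← h0]
    exact norm_nonneg _
  · refine le_of_mul_le_mul_right ?_ h0
    linarith [sq ‖p' - p‖]

/-- On the compact unit ball around x₀, g has a minimum; a far point is controlled by convexity
along the segment to x₀, evaluated at distance one from x₀. -/
theorem exists_linear_lower_bound [ProperSpace X] {g : X → EReal} (hg : IsProper g)
    (hlsc : LowerSemicontinuous g) (hconv : Convex ℝ (epigraph g)) {x₀ : X} (hx₀ : g x₀ ≠ ⊤) :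
    ∃ m k : ℝ, 0 ≤ k ∧ ∀ y, g y ≠ ⊤ → m - k * ‖y - x₀‖ ≤ (g y).toReal := by
  obtain ⟨y₀, hy₀, hmin⟩ := (hlsc.lowerSemicontinuousOn _).exists_isMinOn
    ⟨x₀, Metric.mem_closedBall_self zero_le_one⟩ (isCompact_closedBall x₀ 1)
  have hle : ∀ y ∈ Metric.closedBall x₀ 1, g y ≠ ⊤ → (g y₀).toReal ≤ (g y).toReal :=
    fun y hy hyt => EReal.toReal_le_toReal (hmin hy) (hg.1 _) hyt
  have h0 := hle x₀ (Metric.mem_closedBall_self zero_le_one) hx₀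
  refine ⟨(g y₀).toReal, (g x₀).toReal - (g y₀).toReal, by linarith, fun y hy => ?_⟩
  rcases le_or_gt ‖y - x₀‖ 1 with h | h
  · have h1 := hle y (by rwa [Metric.mem_closedBall, dist_eq_norm]) hy
    nlinarith [norm_nonneg (y - x₀)]
  · have hpos : 0 < ‖y - x₀‖ := by linarith
    obtain ⟨h1, h2⟩ := toReal_le_of_convex_epigraph hg.1 hconv hx₀ hy
      (inv_nonneg.2 hpos.le) (inv_le_one_of_one_le₀ h.le)
    have h3 := hle _ (by
      rw [Metric.mem_closedBall, dist_eq_norm, add_sub_cancel_left, norm_smul, norm_inv, norm_norm,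
        inv_mul_cancel₀ hpos.ne']) h1
    have h4 := mul_le_mul_of_nonneg_left (h3.trans h2) hpos.le
    rw [mul_add, mul_inv_cancel_left₀ hpos.ne'] at h4
    nlinarith

theorem nonempty_prox [ProperSpace X] {g : X → EReal} (hg : IsProper g)
    (hlsc : LowerSemicontinuous g) (hconv : Convex ℝ (epigraph g)) {γ : ℝ} (hγ : 0 < γ) (u : X) :
    (prox γ g u).Nonempty := by
  obtain ⟨x₀, hx₀⟩ := hg.2
  obtain ⟨m, k, hk, hm⟩ := exists_linear_lower_bound hg hlsc hconv hx₀
  set c := (g x₀).toReal + 1 / (2 * γ) * ‖x₀ - u‖ ^ 2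
  set T := |c - m + k * ‖x₀ - u‖|
  -- Outside this ball the quadratic term exceeds (k + T)‖y - u‖: the k part pays for the linear
  -- decay of g, and T, using ‖y - u‖ ≥ 1, lifts the objective above its value c at x₀. The bound
  -- ‖x₀ - u‖ keeps x₀ inside.
  set R := max (max 1 ‖x₀ - u‖) (2 * γ * (k + T))
  have hlscsum : LowerSemicontinuous fun y => g y + ((1 / (2 * γ) * ‖y - u‖ ^ 2 : ℝ) : EReal) := by
    refine hlsc.add' (Continuous.lowerSemicontinuous ?_) fun y => ?_
    · exact continuous_coe_real_ereal.comp (by fun_prop)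
    · exact EReal.continuousAt_add (.inr (EReal.coe_ne_bot _)) (.inl (hg.1 y))
  have hx₀mem : x₀ ∈ Metric.closedBall u R := by
    rw [Metric.mem_closedBall, dist_eq_norm]
    exact (le_max_right _ _).trans (le_max_left _ _)
  obtain ⟨p, -, hp⟩ := (hlscsum.lowerSemicontinuousOn _).exists_isMinOn ⟨x₀, hx₀mem⟩
    (isCompact_closedBall u R)
  refine ⟨p, fun y => ?_⟩
  by_cases hyR : y ∈ Metric.closedBall u R
  · exact hp hyR
  refine (hp hx₀mem).trans ?_
  by_cases hy : g y = ⊤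
  · rw [hy, EReal.top_add_coe]
    exact le_top
  change g x₀ + ((1 / (2 * γ) * ‖x₀ - u‖ ^ 2 : ℝ) : EReal) ≤ _
  rw [← EReal.coe_toReal hy (hg.1 y), ← EReal.coe_toReal hx₀ (hg.1 x₀), ← EReal.coe_add,
    ← EReal.coe_add, EReal.coe_le_coe_iff]
  rw [Metric.mem_closedBall, dist_eq_norm, not_le] at hyR
  have h1 : 1 ≤ ‖y - u‖ := ((le_max_left _ _).trans (le_max_left _ _)).trans hyR.le
  have h2 : 2 * γ * (k + T) ≤ ‖y - u‖ := (le_max_right _ _).trans hyR.le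
  have h3 : ‖y - x₀‖ ≤ ‖y - u‖ + ‖x₀ - u‖ := by
    rw [norm_sub_rev x₀ u]
    exact norm_sub_le_norm_sub_add_norm_sub y u x₀
  have h4 : k + T ≤ 1 / (2 * γ) * ‖y - u‖ := by
    rw [one_div, ← div_eq_inv_mul, le_div_iff₀ (by positivity)]
    linarith
  have h5 : (k + T) * ‖y - u‖ ≤ 1 / (2 * γ) * ‖y - u‖ ^ 2 := by
    rw [sq, ← mul_assoc]
    gcongr
  have h6 : T ≤ T * ‖y - u‖ := le_mul_of_one_le_right (abs_nonneg _) h1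
  have h7 : c - m + k * ‖x₀ - u‖ ≤ T := le_abs_self _
  have h8 := mul_le_mul_of_nonneg_left h3 hk
  have h9 := hm y hy
  change c ≤ _
  linarith

theorem exists_prox_eq_singleton [ProperSpace X] {g : X → EReal} (hg : IsProper g)
    (hlsc : LowerSemicontinuous g) (hconv : Convex ℝ (epigraph g)) {γ : ℝ} (hγ : 0 < γ) (u : X) :
    ∃ p, prox γ g u = {p} := by
  obtain ⟨p, hp⟩ := nonempty_prox hg hlsc hconv hγ u
  refine ⟨p, Set.eq_singleton_iff_unique_mem.2 ⟨hp, fun q hq => ?_⟩⟩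
  have h := norm_sub_le_of_mem_prox hg hconv hγ hp hq
  rw [sub_self, norm_zero] at h
  exact sub_eq_zero.1 (norm_le_zero_iff.1 h)

end Prox

end VarAnalysis

namespace VarAnalysis

/-! ### The envelope, its gradient, and the graph transformation. -/

section Envelope

variable {X : Type*} [NormedAddCommGroup X] [InnerProductSpace ℝ X]

theorem gradient_quadratic_form [CompleteSpace X] {A : X →L[ℝ] X}
    (hA : ∀ x y, inner ℝ (A x) y = inner ℝ x (A y)) (b : X) (α : ℝ) (x : X) :
    gradient (fun y => 1 / 2 * inner ℝ (A y) y + inner ℝ b y + α) x = A x + b := by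
  refine HasGradientAt.gradient ?_
  rw [hasGradientAt_iff_hasFDerivAt]
  have h1 := (((A.hasFDerivAt (x := x)).inner ℝ (hasFDerivAt_id x)).const_mul (1 / 2)).add
    ((hasFDerivAt_const b x).inner ℝ (hasFDerivAt_id x))
  refine (h1.add_const α).congr_fderiv ?_
  ext d
  simp [hA d x, real_inner_comm d (A x)]
  ring

/-- The function of `x` and `y` whose infimum over `y` is the forward-backward envelope of
`½⟨A x, x⟩ + ⟨b, x⟩ + α` and `g`, for `y` in the domain of `g`. -/
noncomputable def forwardBackwardModel (A : X →L[ℝ] X) (b : X) (α γ : ℝ) (g : X → EReal)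
    (x y : X) : ℝ :=
  1 / 2 * inner ℝ (A x) x + inner ℝ b x + α + inner ℝ (A x + b) (y - x) + (g y).toReal +
    1 / (2 * γ) * ‖y - x‖ ^ 2

theorem forwardBackwardModel_eq_prox_objective (A : X →L[ℝ] X) (b : X) (α : ℝ) {γ : ℝ}
    (hγ : 0 < γ) (g : X → EReal) (x y : X) :
    forwardBackwardModel A b α γ g x y =
      ((g y).toReal + 1 / (2 * γ) * ‖y - (x - γ • (A x + b))‖ ^ 2) +
        (1 / 2 * inner ℝ (A x) x + inner ℝ b x + α - γ / 2 * ‖A x + b‖ ^ 2) := by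
  have h : y - (x - γ • (A x + b)) = (y - x) + γ • (A x + b) := by abel
  rw [forwardBackwardModel, h, norm_add_sq_real, inner_smul_right, norm_smul, mul_pow,
    Real.norm_eq_abs, sq_abs, real_inner_comm (y - x) (A x + b)]
  field_simp
  ring

theorem forwardBackwardModel_le {A : X →L[ℝ] X} (b : X) (α : ℝ) {γ : ℝ} (hγ : 0 < γ)
    {g : X → EReal} (hg : IsProper g) {x p y : X} (hp : p ∈ prox γ g (x - γ • (A x + b)))
    (hy : g y ≠ ⊤) :
    forwardBackwardModel A b α γ g x p ≤ forwardBackwardModel A b α γ g x y := by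
  rw [forwardBackwardModel_eq_prox_objective A b α hγ,
    forwardBackwardModel_eq_prox_objective A b α hγ]
  linarith [((mem_prox_iff hg).1 hp).2 y hy]

/-- For fixed y the model is exactly quadratic in x, with Hessian A - 2A + γ⁻¹I = γ⁻¹B. -/
theorem forwardBackwardModel_add {A B : X →L[ℝ] X}
    (hA : ∀ x y, inner ℝ (A x) y = inner ℝ x (A y)) (b : X) (α : ℝ) {γ : ℝ} (hγ : 0 < γ)
    (hB : ∀ x, B x = x - γ • A x) (g : X → EReal) (x d y : X) :
    forwardBackwardModel A b α γ g (x + d) y = forwardBackwardModel A b α γ g x y +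
      inner ℝ ((1 / γ) • B (x - y)) d + 1 / (2 * γ) * inner ℝ (B d) d := by
  have h : y - (x + d) = (y - x) - d := by abel
  simp only [forwardBackwardModel, h, norm_sub_sq_real (y - x) d, hB, map_add, map_sub,
    inner_add_left, inner_add_right, inner_sub_left, inner_sub_right, inner_smul_left,
    conj_trivial, real_inner_self_eq_norm_sq, hA d x, hA d y, real_inner_comm _ d]
  field_simp
  ring

theorem forwardBackwardEnvelope_eq_coe [CompleteSpace X] {A : X →L[ℝ] X}
    (hA : ∀ x y, inner ℝ (A x) y = inner ℝ x (A y)) (b : X) (α : ℝ) {γ : ℝ} (hγ : 0 < γ)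
    {g : X → EReal} (hg : IsProper g) {P : X → X} (hP : ∀ u, P u ∈ prox γ g u) :
    forwardBackwardEnvelope γ (fun y => 1 / 2 * inner ℝ (A y) y + inner ℝ b y + α) g =
      fun x => ((forwardBackwardModel A b α γ g x (P (x - γ • (A x + b))) : ℝ) : EReal) := by
  funext x
  have hval : ∀ y, g y ≠ ⊤ → ((1 / 2 * inner ℝ (A x) x + inner ℝ b x + α +
      inner ℝ (A x + b) (y - x) : ℝ) : EReal) + g y + ((1 / (2 * γ) * ‖y - x‖ ^ 2 : ℝ) : EReal) =
      ((forwardBackwardModel A b α γ g x y : ℝ) : EReal) := fun y hy => by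
    conv_lhs => rw [← EReal.coe_toReal hy (hg.1 y)]
    norm_cast
  simp only [forwardBackwardEnvelope, gradient_quadratic_form hA]
  have hp := hP (x - γ • (A x + b))
  refine le_antisymm ((iInf_le _ _).trans (hval _ ((mem_prox_iff hg).1 hp).1).le)
    (le_iInf fun y => ?_)
  by_cases hy : g y = ⊤
  · rw [hy, EReal.coe_add_top, EReal.top_add_coe]
    exact le_top
  · rw [hval y hy, EReal.coe_le_coe_iff]
    exact forwardBackwardModel_le b α hγ hg hp hy

theorem subdifferential_forwardBackwardEnvelope [CompleteSpace X] {A B : X →L[ℝ] X}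
    (hA : ∀ x y, inner ℝ (A x) y = inner ℝ x (A y)) (b : X) (α : ℝ) {γ : ℝ} (hγ : 0 < γ)
    (hB : ∀ x, B x = x - γ • A x) {g : X → EReal} (hg : IsProper g)
    (hconv : Convex ℝ (epigraph g)) {P : X → X} (hP : ∀ u, P u ∈ prox γ g u) (x : X) :
    subdifferential
      (forwardBackwardEnvelope γ (fun y => 1 / 2 * inner ℝ (A y) y + inner ℝ b y + α) g) x =
      {(1 / γ) • B (x - P (x - γ • (A x + b)))} := by
  rw [forwardBackwardEnvelope_eq_coe hA b α hγ hg hP]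
  refine subdifferential_coe_eq_singleton (C := 1 / (2 * γ) * ‖B‖) (M := 1 / γ * (‖B‖ * (1 + ‖B‖)))
    (G := fun x => (1 / γ) • B (x - P (x - γ • (A x + b)))) (fun x y => ?_) (fun x y => ?_) x
  -- Testing the infimum at y with the minimizer belonging to x gives the quadratic upper estimate.
  · have h1 := forwardBackwardModel_le b α hγ hg (hP (y - γ • (A y + b)))
      ((mem_prox_iff hg).1 (hP (x - γ • (A x + b)))).1
    have h2 := forwardBackwardModel_add hA b α hγ hB g x (y - x) (P (x - γ • (A x + b)))
    rw [add_sub_cancel] at h2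
    have h3 : inner ℝ (B (y - x)) (y - x) ≤ ‖B‖ * ‖y - x‖ ^ 2 := by
      refine (real_inner_le_norm _ _).trans ?_
      rw [sq, ← mul_assoc]
      gcongr
      exact B.le_opNorm _
    have h4 : 1 / (2 * γ) * inner ℝ (B (y - x)) (y - x) ≤ 1 / (2 * γ) * ‖B‖ * ‖y - x‖ ^ 2 := by
      rw [mul_assoc]
      gcongr
    linarith
  · have h1 := norm_sub_le_of_mem_prox hg hconv hγ (hP (x - γ • (A x + b)))
      (hP (y - γ • (A y + b)))
    have h2 : (y - γ • (A y + b)) - (x - γ • (A x + b)) = B (y - x) := by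
      rw [hB, map_sub]
      module
    rw [h2] at h1
    rw [← smul_sub, ← map_sub, norm_smul, Real.norm_of_nonneg (by positivity), mul_assoc, mul_assoc]
    gcongr
    refine (B.le_opNorm _).trans ?_
    gcongr
    rw [sub_sub_sub_comm]
    refine (norm_sub_le _ _).trans ?_
    linarith [h1.trans (B.le_opNorm _)]

/-- The linear change of variables `(x, y) ↦ (x - γ D y, D y - A x)`, where `D` is the inverse of
`B = 1 - γ A`; up to a translation it carries the graph of the gradient of the forward-backward
envelope to the graph of `∂g`. -/
noncomputable def envelopeGraphEquiv {A B D : X →L[ℝ] X} {γ : ℝ}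
    (hB : ∀ x, B x = x - γ • A x) (hBD : ∀ x, B (D x) = x) (hDB : ∀ x, D (B x) = x) :
    WithLp 2 (X × X) ≃L[ℝ] WithLp 2 (X × X) where
  toFun q := WithLp.toLp 2 (q.fst - γ • D q.snd, D q.snd - A q.fst)
  invFun q := WithLp.toLp 2 (D (q.fst + γ • q.snd), A q.fst + q.snd)
  map_add' q r := by
    change WithLp.toLp 2 ((q.fst + r.fst) - γ • D (q.snd + r.snd),
      D (q.snd + r.snd) - A (q.fst + r.fst)) = WithLp.toLp 2
        ((q.fst - γ • D q.snd) + (r.fst - γ • D r.snd), (D q.snd - A q.fst) + (D r.snd - A r.fst))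
    rw [map_add, map_add]
    congr 2 <;> module
  map_smul' s q := by
    change WithLp.toLp 2 (s • q.fst - γ • D (s • q.snd), D (s • q.snd) - A (s • q.fst)) =
      WithLp.toLp 2 (s • (q.fst - γ • D q.snd), s • (D q.snd - A q.fst))
    rw [map_smul, map_smul]
    congr 2 <;> module
  left_inv q := by
    have h1 : q.fst - γ • D q.snd + γ • (D q.snd - A q.fst) = B q.fst := by
      rw [hB]
      module
    have h2 : A (q.fst - γ • D q.snd) + (D q.snd - A q.fst) = B (D q.snd) := by
      rw [hB, map_sub, map_smul]
      module
    change WithLp.toLp 2 (D (q.fst - γ • D q.snd + γ • (D q.snd - A q.fst)),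
      A (q.fst - γ • D q.snd) + (D q.snd - A q.fst)) = q
    rw [h1, h2, hDB, hBD]
    rfl
  right_inv q := by
    -- A commutes with B = 1 - γA, hence with its inverse.
    have hcomm : ∀ x, A (D x) = D (A x) := fun x => by
      rw [← hDB (A (D x)), hB, ← map_smul, ← map_sub, ← hB, hBD]
    have h1 : D (q.fst + γ • q.snd) - γ • D (A q.fst + q.snd) = D (B q.fst) := by
      rw [hB]
      simp only [map_add, map_sub, map_smul]
      module
    have h2 : D (A q.fst + q.snd) - A (D (q.fst + γ • q.snd)) = D (B q.snd) := by
      rw [hB, hcomm]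
      simp only [map_add, map_sub, map_smul]
      module
    change WithLp.toLp 2 (D (q.fst + γ • q.snd) - γ • D (A q.fst + q.snd),
      D (A q.fst + q.snd) - A (D (q.fst + γ • q.snd))) = q
    rw [h1, h2, hDB, hDB]
    rfl
  continuous_toFun := by fun_prop
  continuous_invFun := by fun_prop

theorem adjoint_envelopeGraphEquiv [CompleteSpace X] {A B D : X →L[ℝ] X} {γ : ℝ}
    (hA : ∀ x y, inner ℝ (A x) y = inner ℝ x (A y))
    (hB : ∀ x, B x = x - γ • A x) (hBD : ∀ x, B (D x) = x) (hDB : ∀ x, D (B x) = x) (w z : X) :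
    ContinuousLinearMap.adjoint
      (envelopeGraphEquiv hB hBD hDB : WithLp 2 (X × X) →L[ℝ] WithLp 2 (X × X))
      (WithLp.toLp 2 (D z - A w, -(w - γ • D z))) = WithLp.toLp 2 (z, -w) := by
  have hBs : ∀ x y, inner ℝ (B x) y = inner ℝ x (B y) := fun x y => by
    rw [hB, hB, inner_sub_left, inner_sub_right, inner_smul_left, inner_smul_right, hA,
      conj_trivial]
  refine ext_inner_right ℝ fun q => ?_
  rw [ContinuousLinearMap.adjoint_inner_left, WithLp.prod_inner_apply, WithLp.prod_inner_apply]
  change inner ℝ (D z - A w) (q.fst - γ • D q.snd) + inner ℝ (-(w - γ • D z)) (D q.snd - A q.fst) =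
    inner ℝ z q.fst + inner ℝ (-w) q.snd
  -- This and `h2` both rest on BD = 1; the two remaining terms γ⟨Dz, Dy⟩, with y the second
  -- component of q, cancel.
  have h1 : inner ℝ (D z) q.fst = inner ℝ z q.fst + γ * inner ℝ (D z) (A q.fst) := by
    have h := hBs (D z) q.fst
    rw [hBD, hB q.fst, inner_sub_right, inner_smul_right] at h
    linarith
  have h2 : inner ℝ w (D q.snd) = inner ℝ w q.snd + γ * inner ℝ w (A (D q.snd)) := by
    have h : D q.snd = q.snd + γ • A (D q.snd) := by
      have := hB (D q.snd)
      rw [hBD] at this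
      exact (sub_eq_iff_eq_add.1 this.symm)
    conv_lhs => rw [h]
    rw [inner_add_right, inner_smul_right]
  simp only [inner_sub_left, inner_sub_right, inner_neg_left, inner_smul_left, inner_smul_right,
    conj_trivial, hA w]
  linarith

theorem gph_subdifferential_forwardBackwardEnvelope [CompleteSpace X] {A B D : X →L[ℝ] X}
    (hA : ∀ x y, inner ℝ (A x) y = inner ℝ x (A y)) (b : X) (α : ℝ) {γ : ℝ} (hγ : 0 < γ)
    (hB : ∀ x, B x = x - γ • A x) (hBD : ∀ x, B (D x) = x) (hDB : ∀ x, D (B x) = x)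
    {g : X → EReal} (hg : IsProper g) (hconv : Convex ℝ (epigraph g)) {P : X → X}
    (hP : ∀ u, prox γ g u = {P u}) :
    gph (subdifferential
      (forwardBackwardEnvelope γ (fun y => 1 / 2 * inner ℝ (A y) y + inner ℝ b y + α) g)) =
      (fun q => envelopeGraphEquiv hB hBD hDB q + WithLp.toLp 2 (0, -b)) ⁻¹'
        gph (subdifferential g) := by
  ext q
  have hP' : ∀ u, P u ∈ prox γ g u := fun u => (hP u).symm ▸ Set.mem_singleton _
  change q.snd ∈ subdifferential _ q.fst ↔
    D q.snd - A q.fst + -b ∈ subdifferential g (q.fst - γ • D q.snd + 0)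
  rw [subdifferential_forwardBackwardEnvelope hA b α hγ hB hg hconv hP', Set.mem_singleton_iff]
  have h : D q.snd - A q.fst + -b = (1 / γ) •
      (q.fst - γ • (A q.fst + b) - (q.fst - γ • D q.snd)) := by
    have h1 : q.fst - γ • (A q.fst + b) - (q.fst - γ • D q.snd) =
        γ • (D q.snd - A q.fst + -b) := by module
    rw [h1, smul_smul, one_div_mul_cancel hγ.ne', one_smul]
  rw [add_zero, h, ← mem_prox_iff_mem_subdifferential hg hconv hγ, hP, Set.mem_singleton_iff]
  constructor
  · intro hq
    rw [hq, map_smul, hDB, smul_smul, mul_one_div_cancel hγ.ne', one_smul, sub_sub_cancel]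
  · intro hq
    rw [← hq, sub_sub_cancel, map_smul, hBD, smul_smul, one_div_mul_cancel hγ.ne', one_smul]

theorem mem_generalizedHessian_forwardBackwardEnvelope_iff [CompleteSpace X]
    {A B D : X →L[ℝ] X} (hA : ∀ x y, inner ℝ (A x) y = inner ℝ x (A y)) (b : X) (α : ℝ) {γ : ℝ}
    (hγ : 0 < γ) (hB : ∀ x, B x = x - γ • A x) (hBD : ∀ x, B (D x) = x) (hDB : ∀ x, D (B x) = x)
    {g : X → EReal} (hg : IsProper g) (hconv : Convex ℝ (epigraph g)) {P : X → X}
    (hP : ∀ u, prox γ g u = {P u}) {x u : X} (hu : u = x - γ • (A x + b)) (w z : X) :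
    z ∈ generalizedHessian
        (forwardBackwardEnvelope γ (fun y => 1 / 2 * inner ℝ (A y) y + inner ℝ b y + α) g) x
        ((1 / γ) • B (x - P u)) w ↔
      D z - A w ∈ generalizedHessian g (P u) ((1 / γ) • (u - P u)) (w - γ • D z) := by
  have hpoint : envelopeGraphEquiv hB hBD hDB (WithLp.toLp 2 (x, (1 / γ) • B (x - P u))) +
      WithLp.toLp 2 (0, -b) = WithLp.toLp 2 (P u, (1 / γ) • (u - P u)) := by
    change WithLp.toLp 2 (x - γ • D ((1 / γ) • B (x - P u)) + 0,
      D ((1 / γ) • B (x - P u)) - A x + -b) = _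
    rw [map_smul, hDB, smul_smul, mul_one_div_cancel hγ.ne', one_smul, sub_sub_cancel, add_zero]
    congr 2
    have h : u - P u = (x - P u) + γ • (-(A x + b)) := by
      rw [hu]
      module
    rw [h, smul_add, smul_smul, one_div_mul_cancel hγ.ne', one_smul]
    abel
  change WithLp.toLp 2 (z, -w) ∈ limitingNormalCone (gph _) _ ↔
    WithLp.toLp 2 (D z - A w, -(w - γ • D z)) ∈ limitingNormalCone (gph _) _
  rw [gph_subdifferential_forwardBackwardEnvelope hA b α hγ hB hBD hDB hg hconv hP,
    ← adjoint_envelopeGraphEquiv hA hB hBD hDB w z, adjoint_mem_limitingNormalCone_preimage_iff,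
    hpoint]

end Envelope

end VarAnalysis

/-! ### Specialization to matrices. -/

theorem mainTheorem8 (n : ℕ) (A : Matrix (Fin n) (Fin n) ℝ) (hA : A.PosSemidef)
    (b : EuclideanSpace ℝ (Fin n)) (α : ℝ) (g : EuclideanSpace ℝ (Fin n) → EReal)
    (hg_proper : VarAnalysis.IsProper g) (hg_lsc : LowerSemicontinuous g)
    (hg_convex : Convex ℝ (VarAnalysis.epigraph g))
    (γ : ℝ) (hγ : 0 < γ) (B : Matrix (Fin n) (Fin n) ℝ) (hB : B = 1 - γ • A)
    (hB_pos : B.PosDef) (xbar ubar : EuclideanSpace ℝ (Fin n))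
    (hu : ubar = xbar - γ • (Matrix.toEuclideanLin A xbar + b)) :
    ∃ p v : EuclideanSpace ℝ (Fin n),
      VarAnalysis.prox γ g ubar = {p} ∧
      VarAnalysis.subdifferential
        (VarAnalysis.forwardBackwardEnvelope γ (VarAnalysis.quadratic A b α) g) xbar = {v} ∧
      ∀ w z : EuclideanSpace ℝ (Fin n),
        z ∈ VarAnalysis.generalizedHessian
            (VarAnalysis.forwardBackwardEnvelope γ (VarAnalysis.quadratic A b α) g) xbar v w ↔
          Matrix.toEuclideanLin B⁻¹ z - Matrix.toEuclideanLin A w ∈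
            VarAnalysis.generalizedHessian g p ((1 / γ) • (ubar - p))
              (w - γ • Matrix.toEuclideanLin B⁻¹ z) := by
  set A' := Matrix.toEuclideanCLM (n := Fin n) (𝕜 := ℝ) A
  set B' := Matrix.toEuclideanCLM (n := Fin n) (𝕜 := ℝ) B with hB'
  set D' := Matrix.toEuclideanCLM (n := Fin n) (𝕜 := ℝ) B⁻¹ with hD'
  -- Positive definiteness makes the matrix inverse a genuine two-sided inverse.
  have hdet : IsUnit B.det := (Matrix.isUnit_iff_isUnit_det B).1 hB_pos.isUnit
  have hsymm : ∀ x y, inner ℝ (A' x) y = inner ℝ x (A' y) :=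
    Matrix.isSymmetric_toEuclideanLin_iff.2 hA.isHermitian
  have hBA : ∀ x, B' x = x - γ • A' x := fun x => by
    rw [hB', hB, map_sub, map_one, map_smul]
    rfl
  have hBD : ∀ x, B' (D' x) = x := fun x => by
    rw [← mul_apply_eq_comp, hB', hD', ← map_mul, Matrix.mul_nonsing_inv B hdet,
      map_one]
    rfl
  have hDB : ∀ x, D' (B' x) = x := fun x => by
    rw [← mul_apply_eq_comp, hB', hD', ← map_mul, Matrix.nonsing_inv_mul B hdet,
      map_one]
    rfl
  choose P hP using fun u =>
    VarAnalysis.exists_prox_eq_singleton hg_proper hg_lsc hg_convex hγ u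
  refine ⟨P ubar, (1 / γ) • B' (xbar - P ubar), hP ubar, ?_, fun w z => ?_⟩
  · rw [hu]
    exact VarAnalysis.subdifferential_forwardBackwardEnvelope hsymm b α hγ hBA hg_proper hg_convex
      (fun u => (hP u).symm ▸ Set.mem_singleton _) xbar
  · exact VarAnalysis.mem_generalizedHessian_forwardBackwardEnvelope_iff hsymm b α hγ hBA hBD hDB
      hg_proper hg_convex hP hu w z
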